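/- Let $\mathbb{A}$ be a partial combinatory algebra with combinators $\mathsf{k},\mathsf{s}$, let $\mathbb{A}'\subseteq\mathbb{A}$ be an elementary subalgebra (a subset that contains $\mathsf{k},\mathsf{s}$ and is closed under application), and let $\mathsf{RT}(\mathbb{A},\mathbb{A}')$ be the relative realizability topos: its objects are sets with a $\mathcal{P}(\mathbb{A})$-valued symmetric and transitive equality, its morphisms are equivalence classes of functional relations, and validity means having a realizer in $\mathbb{A}'$. Let $\Omega=(\mathcal{P}(\mathbb{A}),\Leftrightarrow)$ be its object of truth values. A Lawvere–Tierney topology is a morphism $j:\Omega\to\Omega$ that is monotone, inflationary and idempotent in the internal logic. For a predicate $P$ on an object $X$, the oracle modality $\mathsf{O}_P:\Omega\to\Omega$ is defined internally by letting $\mathsf{O}_P\,s$ be the truth value inductively generated by $s\Rightarrow \mathsf{O}_P\,s$ and $\forall a{:}X.\,((P\,a\Rightarrow \mathsf{O}_P\,s)\Rightarrow \mathsf{O}_P\,s)$. A map $J:\mathcal{P}(\mathbb{A})\to\mathcal{P}(\mathbb{A})$ represents a morphism $j:\Omega\to\Omega$ if $J$ respects $\Leftrightarrow$ (with a realizer in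 $\mathbb{A}'$) and $j$ is the morphism that it induces. Let $\langle\cdot,\cdot\rangle$ be the standard pairing, $\langle a,b,c\rangle=\langle a,\langle b,c\rangle\rangle$, and $\overline{n}$ the Curry numerals. **Theorem.** For every morphism $j:\Omega\to\Omega$ in $\mathsf{RT}(\mathbb{A},\mathbb{A}')$ the following are equivalent. 1. $j$ is a Lawvere–Tierney topology. 2. There are a partitioned assembly $(X,\rho)$ (a set $X$ with a map $\rho:X\to\mathbb{A}$) and a predicate $P:X\to\mathcal{P}(\mathbb{A})$ on it such that $j$ is the oracle modality $\mathsf{O}_P$ and $j$ is represented by the map that sends $S\subseteq\mathbb{A}$ to the least $T\subseteq\mathbb{A}$ with $$T=\{\langle\overline{0},a\rangle\mid a\in S\}\cup\bigcup_{x\in X}\{\langle\overline{1},\langle\rho(x),c\rangle\rangle\mid c\in\mathbb{A},\ \forall d\in P(x)\,(c\,d\text{ is defined and }c\,d\in T)\}.$$ 3. There is an extended Weihrauch predicate $f:\mathbb{A}\to\mathcal{P}(\mathcal{P}(\mathbb{A}))$ such that $j$ is represented by the map that sends $S\subseteq\mathbb{A}$ to the least $T\subseteq\mathbb{A}$ with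 $$T=\{\langle\overline{0},a\rangle\mid a\in S\}\cup\bigcup_{b\in\mathbb{A}}\bigcup_{\theta\in f(b)}\{\langle\overline{1},b,c\rangle\mid c\in\mathbb{A},\ \forall d\in\theta\,(c\,d\text{ is defined and }c\,d\in T)\}.$$ -/

import Mathlib

open CategoryTheory

universe u

/-! ### Partial combinatory algebras -/

/-- A partial combinatory algebra: a set with a partial application and combinators `k`, `s`. Equality of
`Part`s is Kleene equality; application is extended strictly to possibly undefined arguments
through `Part.bind`. -/
class PCA (A : Type u) where
  /-- partial application -/
  app : A → A → Part A
  /-- the combinator `k` -/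
  k : A
  /-- the combinator `s` -/
  s : A
  k_app : ∀ x y : A, ((app k x).bind fun u => app u y) = Part.some x
  s_dom : ∀ x y : A, ((app s x).bind fun u => app u y).Dom
  s_app : ∀ x y z : A, (((app s x).bind fun u => app u y).bind fun v => app v z) =
    (app x z).bind fun u => (app y z).bind fun v => app u v

namespace PCA

section Combinators

variable {A : Type u} [PCA A]

/-- Strict application of partial elements. -/
def ap (x y : Part A) : Part A := x.bind fun a => y.bind fun b => app a b

theorem k_dom (x : A) : (app k x).Dom := by
  have h : ((app k x).bind fun u => app u x).Dom := by rw [k_app]; trivial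
  exact h.1

/-- The (always defined) element `k x`. -/
def kE (x : A) : A := (app k x).get (k_dom x)

/-- The (always defined) element `s x y`. -/
def sE (x y : A) : A := ((app s x).bind fun u => app u y).get (s_dom x y)

/-- The identity combinator `i = s k k`. -/
def iE : A := sE k k

/-- The pair `⟨a, b⟩ = λ z. z a b`, with the abstraction spelled out as
`s (s i (k a)) (k b)`. -/
def pair (a b : A) : A := sE (sE iE (kE a)) (kE b)

/-- The Curry numerals: `0 = i` and `n + 1 = ⟨k i, n⟩`, where `k i` is the boolean `false`. -/
def numeral : ℕ → A
  | 0 => iE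
  | n + 1 => pair (kE iE) (numeral n)

end Combinators

end PCA

/-- An elementary subalgebra `A' ⊆ A`: a subset closed under application that contains the
combinators `k` and `s` of `A`. -/
structure ElementarySubPCA (A : Type u) [PCA A] where
  /-- the underlying subset -/
  carrier : Set A
  k_mem : PCA.k ∈ carrier
  s_mem : PCA.s ∈ carrier
  app_mem : ∀ a ∈ carrier, ∀ b ∈ carrier, ∀ c ∈ PCA.app a b, c ∈ carrier

/-! ### Realizability logic

Truth values are subsets of `A`. Universal and existential quantifiers are
intersections `⋂` and unions `⋃`, and a truth value holds when it has a realizer in `A'`. -/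

namespace Rz

open PCA

section Connectives

variable {A : Type u} [PCA A]

/-- Conjunction of truth values. -/
def conj (S T : Set A) : Set A := {e | ∃ a ∈ S, ∃ b ∈ T, e = pair a b}

/-- Implication of truth values: `c` realizes `S ⇒ T` if `c d` is defined and in `T` for all
`d ∈ S`. -/
def imp (S T : Set A) : Set A := {c | ∀ d ∈ S, ∃ e ∈ app c d, e ∈ T}

/-- Equivalence of truth values. -/
def equ (S T : Set A) : Set A := conj (imp S T) (imp T S)

/-- A truth value holds if it is realized by an element of the subalgebra. -/
def Holds (A' : ElementarySubPCA A) (S : Set A) : Prop := ∃ a ∈ A'.carrier, a ∈ S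

/-- Uniformly realized entailment of families of truth values. -/
def Ent (A' : ElementarySubPCA A) {I : Type*} (φ ψ : I → Set A) : Prop :=
  Holds A' (⋂ i, imp (φ i) (ψ i))

end Connectives

section Calculus

variable {A : Type u} [PCA A] {A' : ElementarySubPCA A} {I J : Type*}

theorem some_kE (x : A) : app k x = Part.some (kE x) := (Part.some_get (k_dom x)).symm

theorem some_sE (x y : A) : ((app s x).bind fun u => app u y) = Part.some (sE x y) :=
  (Part.some_get (s_dom x y)).symm

@[simp] theorem app_kE (x y : A) : app (kE x) y = Part.some x := by
  have h := k_app x y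
  rwa [some_kE, Part.bind_some] at h

theorem app_sE (x y z : A) :
    app (sE x y) z = (app x z).bind fun u => (app y z).bind fun v => app u v := by
  have h := s_app x y z
  rwa [some_sE, Part.bind_some] at h

@[simp] theorem app_iE (x : A) : app iE x = Part.some x := by
  rw [iE, app_sE, some_kE, Part.bind_some, Part.bind_some, app_kE]

theorem app_pair (a b z : A) : app (pair a b) z = (app z a).bind fun u => app u b := by
  simp [pair, app_sE]

theorem kE_mem {x : A} (hx : x ∈ A'.carrier) : kE x ∈ A'.carrier :=
  A'.app_mem _ A'.k_mem _ hx _ (Part.get_mem _)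

theorem sE_mem {x y : A} (hx : x ∈ A'.carrier) (hy : y ∈ A'.carrier) : sE x y ∈ A'.carrier := by
  have h : sE x y ∈ (app s x).bind fun u => app u y := Part.get_mem _
  obtain ⟨u, hu, h⟩ := Part.mem_bind_iff.1 h
  exact A'.app_mem _ (A'.app_mem _ A'.s_mem _ hx _ hu) _ hy _ h

theorem iE_mem : (iE : A) ∈ A'.carrier := sE_mem A'.k_mem A'.k_mem

theorem ent_iff {φ ψ : I → Set A} :
    Ent A' φ ψ ↔ ∃ e ∈ A'.carrier, ∀ i, ∀ d ∈ φ i, ∃ c ∈ app e d, c ∈ ψ i := by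
  simp [Ent, Holds, imp]

theorem Ent.refl (φ : I → Set A) : Ent A' φ φ :=
  ent_iff.2 ⟨iE, iE_mem, fun _ d hd => ⟨d, by simp, hd⟩⟩

theorem Ent.trans {φ ψ χ : I → Set A} (h : Ent A' φ ψ) (h' : Ent A' ψ χ) : Ent A' φ χ := by
  obtain ⟨e, he, h⟩ := ent_iff.1 h
  obtain ⟨e', he', h'⟩ := ent_iff.1 h'
  refine ent_iff.2 ⟨sE (kE e') e, sE_mem (kE_mem he') he, fun i d hd => ?_⟩
  obtain ⟨c, hc, hc'⟩ := h i d hd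
  obtain ⟨b, hb, hb'⟩ := h' i c hc'
  exact ⟨b, by simpa [app_sE] using ⟨c, hc, hb⟩, hb'⟩

theorem Ent.fst {Γ φ ψ : I → Set A} (h : Ent A' Γ fun i => conj (φ i) (ψ i)) : Ent A' Γ φ := by
  refine h.trans (ent_iff.2 ⟨sE iE (kE k), sE_mem iE_mem (kE_mem A'.k_mem), ?_⟩)
  rintro i _ ⟨a, ha, b, hb, rfl⟩
  exact ⟨a, by simp [app_sE, app_pair, some_kE], ha⟩

theorem Ent.snd {Γ φ ψ : I → Set A} (h : Ent A' Γ fun i => conj (φ i) (ψ i)) : Ent A' Γ ψ := by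
  refine h.trans (ent_iff.2 ⟨sE iE (kE (kE iE)), sE_mem iE_mem (kE_mem (kE_mem iE_mem)), ?_⟩)
  rintro i _ ⟨a, ha, b, hb, rfl⟩
  exact ⟨b, by simp [app_sE, app_pair], hb⟩

/-- A partial function is tracked if application of some element of the subalgebra computes it. -/
def Tracked (A' : ElementarySubPCA A) (f : A → Part A) : Prop :=
  ∃ e ∈ A'.carrier, ∀ x, app e x = f x

theorem tracked_const {c : A} (hc : c ∈ A'.carrier) : Tracked A' fun _ => Part.some c :=
  ⟨kE c, kE_mem hc, fun x => app_kE c x⟩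

theorem tracked_id : Tracked A' (fun x => Part.some x) := ⟨iE, iE_mem, app_iE⟩

theorem Tracked.ap {f g : A → Part A} (hf : Tracked A' f) (hg : Tracked A' g) :
    Tracked A' fun x => ap (f x) (g x) := by
  obtain ⟨e, he, hf⟩ := hf
  obtain ⟨e', he', hg⟩ := hg
  exact ⟨sE e e', sE_mem he he', fun x => by rw [app_sE, hf, hg]; rfl⟩

theorem ap_some (x y : A) : PCA.ap (Part.some x) (Part.some y) = app x y := by simp [PCA.ap]

theorem Tracked.kE {f : A → Part A} (hf : Tracked A' f) :
    Tracked A' fun x => (f x).bind fun u => Part.some (kE u) := by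
  have h := (tracked_const A'.k_mem).ap hf
  convert h using 2 with x
  simp [PCA.ap, some_kE]

theorem Tracked.sE {f g : A → Part A} (hf : Tracked A' f) (hg : Tracked A' g) :
    Tracked A' fun x => (f x).bind fun u => (g x).bind fun v => Part.some (sE u v) := by
  have h := ((tracked_const A'.s_mem).ap hf).ap hg
  convert h using 2 with x
  simp only [PCA.ap, ← some_sE, Part.bind_some, Part.bind_assoc]
  congr 1
  funext u
  refine Part.ext fun z => ?_
  simp only [Part.mem_bind_iff]
  constructor
  · rintro ⟨v, hv, w, hw, hz⟩
    exact ⟨w, hw, v, hv, hz⟩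
  · rintro ⟨w, hw, v, hv, hz⟩
    exact ⟨v, hv, w, hw, hz⟩

theorem Tracked.pair {f g : A → Part A} (hf : Tracked A' f) (hg : Tracked A' g) :
    Tracked A' fun x => (f x).bind fun u => (g x).bind fun v => Part.some (pair u v) := by
  have h := ((tracked_const iE_mem).sE hf.kE).sE hg.kE
  convert h using 2 with x
  simp [PCA.pair, Part.bind_assoc]

theorem Ent.pair {Γ φ ψ : I → Set A} (h : Ent A' Γ φ) (h' : Ent A' Γ ψ) :
    Ent A' Γ fun i => conj (φ i) (ψ i) := by
  obtain ⟨e, he, h⟩ := ent_iff.1 h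
  obtain ⟨e', he', h'⟩ := ent_iff.1 h'
  obtain ⟨p, hp, hpe⟩ := Tracked.pair (A' := A') ⟨e, he, fun _ => rfl⟩ ⟨e', he', fun _ => rfl⟩
  refine ent_iff.2 ⟨p, hp, fun i d hd => ?_⟩
  obtain ⟨a, ha, ha'⟩ := h i d hd
  obtain ⟨b, hb, hb'⟩ := h' i d hd
  refine ⟨PCA.pair a b, ?_, a, ha', b, hb', rfl⟩
  rw [hpe]
  exact Part.mem_bind ha (Part.mem_bind hb (Part.mem_some _))

theorem s_dom_one (x : A) : (app s x).Dom := (s_dom x x).1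

theorem Ent.intro {Γ φ ψ : I → Set A} (h : Ent A' (fun i => conj (Γ i) (φ i)) ψ) :
    Ent A' Γ fun i => imp (φ i) (ψ i) := by
  obtain ⟨e, he, h⟩ := ent_iff.1 h
  have t := (tracked_const (kE_mem he)).sE
    ((((tracked_const A'.s_mem).ap ((tracked_const iE_mem).sE tracked_id.kE)).kE).sE
      (tracked_const A'.k_mem))
  obtain ⟨p, hp, hpe⟩ := t
  refine ent_iff.2 ⟨p, hp, fun i x hx => ?_⟩
  obtain ⟨w, hw⟩ := Part.dom_iff_mem.1 (s_dom_one (PCA.sE PCA.iE (PCA.kE x)))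
  have hw' := Part.eq_some_iff.2 hw
  refine ⟨PCA.sE (PCA.kE e) (PCA.sE (PCA.kE w) k), ?_, fun d hd => ?_⟩
  · rw [hpe]
    simp [PCA.ap, hw']
  · obtain ⟨c, hc, hc'⟩ := h i _ ⟨x, hx, d, hd, rfl⟩
    refine ⟨c, ?_, hc'⟩
    have hq : app w (PCA.kE d) = Part.some (PCA.pair x d) := by
      have := some_sE (PCA.sE PCA.iE (PCA.kE x)) (PCA.kE d)
      rwa [hw', Part.bind_some] at this
    simpa [app_sE, some_kE, hq] using hc

theorem Ent.mp {Γ φ ψ : I → Set A} (h : Ent A' Γ fun i => imp (φ i) (ψ i)) (h' : Ent A' Γ φ) :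
    Ent A' Γ ψ := by
  obtain ⟨e, he, h⟩ := ent_iff.1 h
  obtain ⟨e', he', h'⟩ := ent_iff.1 h'
  refine ent_iff.2 ⟨PCA.sE e e', sE_mem he he', fun i d hd => ?_⟩
  obtain ⟨a, ha, ha'⟩ := h i d hd
  obtain ⟨b, hb, hb'⟩ := h' i d hd
  obtain ⟨c, hc, hc'⟩ := ha' b hb'
  exact ⟨c, by rw [app_sE]; exact Part.mem_bind ha (Part.mem_bind hb hc), hc'⟩

theorem Ent.comap {φ ψ : J → Set A} (h : Ent A' φ ψ) (f : I → J) :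
    Ent A' (fun i => φ (f i)) (fun i => ψ (f i)) := by
  obtain ⟨e, he, h⟩ := ent_iff.1 h
  exact ent_iff.2 ⟨e, he, fun i => h (f i)⟩

theorem Ent.exI {Γ : I → Set A} {φ : I → J → Set A} (f : I → J)
    (h : Ent A' Γ fun i => φ i (f i)) : Ent A' Γ fun i => ⋃ j, φ i j := by
  obtain ⟨e, he, h⟩ := ent_iff.1 h
  refine ent_iff.2 ⟨e, he, fun i d hd => ?_⟩
  obtain ⟨c, hc, hc'⟩ := h i d hd
  exact ⟨c, hc, Set.mem_iUnion.2 ⟨_, hc'⟩⟩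

theorem Ent.exE {Γ ψ : I → Set A} {φ : I → J → Set A} (h : Ent A' Γ fun i => ⋃ j, φ i j)
    (h' : Ent A' (fun p : I × J => conj (Γ p.1) (φ p.1 p.2)) fun p => ψ p.1) : Ent A' Γ ψ := by
  obtain ⟨e, he, h'⟩ := ent_iff.1 h'
  refine ((Ent.refl Γ).pair h).trans (ent_iff.2 ⟨e, he, ?_⟩)
  rintro i _ ⟨a, ha, b, hb, rfl⟩
  obtain ⟨j, hj⟩ := Set.mem_iUnion.1 hb
  exact h' (i, j) _ ⟨a, ha, b, hj, rfl⟩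

end Calculus

end Rz

/-! ### The relative realizability topos -/

open Rz

/-- An object of the relative realizability topos: a set with an equality valued in
truth values that is symmetric and transitive; `eq x x` is the existence predicate. -/
structure RT {A : Type u} [PCA A] (A' : ElementarySubPCA A) : Type (u + 1) where
  /-- the underlying set -/
  carrier : Type u
  /-- the equality, with truth values in the subsets of `A` -/
  eq : carrier → carrier → Set A
  symm : Holds A' (⋂ x, ⋂ y, imp (eq x y) (eq y x))
  trans : Holds A' (⋂ x, ⋂ y, ⋂ z, imp (conj (eq x y) (eq y z)) (eq x z))

/-- A functional relation between objects of the topos. -/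
structure FunRel {A : Type u} [PCA A] {A' : ElementarySubPCA A} (X Y : RT A') : Type u where
  /-- the underlying relation, with truth values in the subsets of `A` -/
  rel : X.carrier → Y.carrier → Set A
  strict : Holds A' (⋂ x, ⋂ y, imp (rel x y) (conj (X.eq x x) (Y.eq y y)))
  ext : Holds A' (⋂ x, ⋂ x', ⋂ y, ⋂ y',
    imp (conj (rel x y) (conj (X.eq x x') (Y.eq y y'))) (rel x' y'))
  single : Holds A' (⋂ x, ⋂ y, ⋂ y', imp (conj (rel x y) (rel x y')) (Y.eq y y'))
  total : Holds A' (⋂ x, imp (X.eq x x) (⋃ y, rel x y))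

namespace RT

section Construction

variable {A : Type u} [PCA A] {A' : ElementarySubPCA A} {I : Type*} {Γ : I → Set A}

theorem ent_symm (X : RT A') {x y : I → X.carrier} (h : Ent A' Γ fun i => X.eq (x i) (y i)) :
    Ent A' Γ fun i => X.eq (y i) (x i) := by
  refine h.trans ?_
  obtain ⟨a, ha, h⟩ := X.symm
  simp only [Set.mem_iInter] at h
  exact ⟨a, ha, Set.mem_iInter.2 fun i => h _ _⟩

theorem ent_trans (X : RT A') {x y z : I → X.carrier} (h : Ent A' Γ fun i => X.eq (x i) (y i))
    (h' : Ent A' Γ fun i => X.eq (y i) (z i)) : Ent A' Γ fun i => X.eq (x i) (z i) := by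
  refine (h.pair h').trans ?_
  obtain ⟨a, ha, h⟩ := X.trans
  simp only [Set.mem_iInter] at h
  exact ⟨a, ha, Set.mem_iInter.2 fun i => h _ _ _⟩

theorem ent_left (X : RT A') {x y : I → X.carrier} (h : Ent A' Γ fun i => X.eq (x i) (y i)) :
    Ent A' Γ fun i => X.eq (x i) (x i) := X.ent_trans h (X.ent_symm h)

variable {X Y Z W : RT A'}

theorem _root_.FunRel.ent_dom (F : FunRel X Y) {x : I → X.carrier} {y : I → Y.carrier}
    (h : Ent A' Γ fun i => F.rel (x i) (y i)) : Ent A' Γ fun i => X.eq (x i) (x i) := by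
  have : Ent A' Γ fun i => conj (X.eq (x i) (x i)) (Y.eq (y i) (y i)) := by
    refine h.trans ?_
    obtain ⟨a, ha, h⟩ := F.strict
    simp only [Set.mem_iInter] at h
    exact ⟨a, ha, Set.mem_iInter.2 fun i => h _ _⟩
  exact this.fst

theorem _root_.FunRel.ent_cod (F : FunRel X Y) {x : I → X.carrier} {y : I → Y.carrier}
    (h : Ent A' Γ fun i => F.rel (x i) (y i)) : Ent A' Γ fun i => Y.eq (y i) (y i) := by
  have : Ent A' Γ fun i => conj (X.eq (x i) (x i)) (Y.eq (y i) (y i)) := by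
    refine h.trans ?_
    obtain ⟨a, ha, h⟩ := F.strict
    simp only [Set.mem_iInter] at h
    exact ⟨a, ha, Set.mem_iInter.2 fun i => h _ _⟩
  exact this.snd

theorem _root_.FunRel.ent_ext (F : FunRel X Y) {x x' : I → X.carrier} {y y' : I → Y.carrier}
    (h : Ent A' Γ fun i => F.rel (x i) (y i)) (hx : Ent A' Γ fun i => X.eq (x i) (x' i))
    (hy : Ent A' Γ fun i => Y.eq (y i) (y' i)) : Ent A' Γ fun i => F.rel (x' i) (y' i) := by
  refine (h.pair (hx.pair hy)).trans ?_
  obtain ⟨a, ha, h⟩ := F.ext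
  simp only [Set.mem_iInter] at h
  exact ⟨a, ha, Set.mem_iInter.2 fun i => h _ _ _ _⟩

theorem _root_.FunRel.ent_single (F : FunRel X Y) {x : I → X.carrier} {y y' : I → Y.carrier}
    (h : Ent A' Γ fun i => F.rel (x i) (y i)) (h' : Ent A' Γ fun i => F.rel (x i) (y' i)) :
    Ent A' Γ fun i => Y.eq (y i) (y' i) := by
  refine (h.pair h').trans ?_
  obtain ⟨a, ha, h⟩ := F.single
  simp only [Set.mem_iInter] at h
  exact ⟨a, ha, Set.mem_iInter.2 fun i => h _ _ _⟩

theorem _root_.FunRel.ent_total (F : FunRel X Y) {x : I → X.carrier}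
    (h : Ent A' Γ fun i => X.eq (x i) (x i)) : Ent A' Γ fun i => ⋃ y, F.rel (x i) y := by
  refine h.trans ?_
  obtain ⟨a, ha, h⟩ := F.total
  simp only [Set.mem_iInter] at h
  exact ⟨a, ha, Set.mem_iInter.2 fun i => h _⟩

/-- Inclusion of functional relations, up to realizers in the subalgebra. -/
def RelLE (F G : FunRel X Y) : Prop := Holds A' (⋂ x, ⋂ y, imp (F.rel x y) (G.rel x y))

theorem relLE_iff {F G : FunRel X Y} :
    RelLE F G ↔ Ent A' (fun p : X.carrier × Y.carrier => F.rel p.1 p.2) fun p => G.rel p.1 p.2 := by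
  simp [RelLE, Ent, Holds]

theorem RelLE.ent {F G : FunRel X Y} (h : RelLE F G) {x : I → X.carrier} {y : I → Y.carrier}
    (h' : Ent A' Γ fun i => F.rel (x i) (y i)) : Ent A' Γ fun i => G.rel (x i) (y i) :=
  h'.trans ((relLE_iff.1 h).comap fun i => (x i, y i))

/-- Functional relations are identified when they are equivalent as predicates. -/
instance relSetoid (X Y : RT A') : Setoid (FunRel X Y) where
  r F G := RelLE F G ∧ RelLE G F
  iseqv :=
    { refl := fun _ => ⟨relLE_iff.2 (Ent.refl _), relLE_iff.2 (Ent.refl _)⟩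
      symm := fun h => ⟨h.2, h.1⟩
      trans := fun h h' => ⟨relLE_iff.2 (h'.1.ent (relLE_iff.1 h.1)),
        relLE_iff.2 (h.2.ent (relLE_iff.1 h'.2))⟩ }

/-- The identity functional relation. -/
def idRel (X : RT A') : FunRel X X where
  rel := X.eq
  strict := by
    have h : Ent A' (fun p : X.carrier × X.carrier => X.eq p.1 p.2)
        fun p => conj (X.eq p.1 p.1) (X.eq p.2 p.2) :=
      (X.ent_left (Ent.refl _)).pair (X.ent_left (X.ent_symm (Ent.refl _)))
    simpa [Ent, Holds] using h
  ext := by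
    have h : Ent A' (fun p : X.carrier × X.carrier × X.carrier × X.carrier =>
        conj (X.eq p.1 p.2.2.1) (conj (X.eq p.1 p.2.1) (X.eq p.2.2.1 p.2.2.2)))
        fun p => X.eq p.2.1 p.2.2.2 := by
      have h := Ent.refl (A' := A') (fun p : X.carrier × X.carrier × X.carrier × X.carrier =>
        conj (X.eq p.1 p.2.2.1) (conj (X.eq p.1 p.2.1) (X.eq p.2.2.1 p.2.2.2)))
      exact X.ent_trans (X.ent_symm h.snd.fst) (X.ent_trans h.fst h.snd.snd)
    simpa [Ent, Holds] using h
  single := by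
    have h : Ent A' (fun p : X.carrier × X.carrier × X.carrier =>
        conj (X.eq p.1 p.2.1) (X.eq p.1 p.2.2)) fun p => X.eq p.2.1 p.2.2 := by
      have h := Ent.refl (A' := A') (fun p : X.carrier × X.carrier × X.carrier =>
        conj (X.eq p.1 p.2.1) (X.eq p.1 p.2.2))
      exact X.ent_trans (X.ent_symm h.fst) h.snd
    simpa [Ent, Holds] using h
  total := by
    have h : Ent A' (fun x : X.carrier => X.eq x x) fun x => ⋃ y, X.eq x y :=
      Ent.exI (fun x => x) (Ent.refl _)
    exact h

/-- Composition of functional relations: `∃ y, F x y ∧ G y z`. -/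
def compRel (F : FunRel X Y) (G : FunRel Y Z) : FunRel X Z where
  rel x z := ⋃ y, conj (F.rel x y) (G.rel y z)
  strict := by
    have h : Ent A' (fun p : X.carrier × Z.carrier => ⋃ y, conj (F.rel p.1 y) (G.rel y p.2))
        fun p => conj (X.eq p.1 p.1) (Z.eq p.2 p.2) := by
      refine Ent.exE (Ent.refl _) ?_
      exact (F.ent_dom (Ent.refl _).snd.fst).pair (G.ent_cod (Ent.refl _).snd.snd)
    simpa [Ent, Holds] using h
  ext := by
    have h : Ent A' (fun p : X.carrier × X.carrier × Z.carrier × Z.carrier =>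
        conj (⋃ y, conj (F.rel p.1 y) (G.rel y p.2.2.1))
          (conj (X.eq p.1 p.2.1) (Z.eq p.2.2.1 p.2.2.2)))
        fun p => ⋃ y, conj (F.rel p.2.1 y) (G.rel y p.2.2.2) := by
      refine Ent.exE (Ent.refl _).fst (Ent.exI Prod.snd ?_)
      have h := Ent.refl (A' := A') fun p : (X.carrier × X.carrier × Z.carrier × Z.carrier) ×
        Y.carrier => conj (conj (⋃ y, conj (F.rel p.1.1 y) (G.rel y p.1.2.2.1))
          (conj (X.eq p.1.1 p.1.2.1) (Z.eq p.1.2.2.1 p.1.2.2.2)))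
          (conj (F.rel p.1.1 p.2) (G.rel p.2 p.1.2.2.1))
      have hy := F.ent_cod h.snd.fst
      exact (F.ent_ext h.snd.fst h.fst.snd.fst hy).pair (G.ent_ext h.snd.snd hy h.fst.snd.snd)
    simpa [Ent, Holds] using h
  single := by
    have h : Ent A' (fun p : X.carrier × Z.carrier × Z.carrier =>
        conj (⋃ y, conj (F.rel p.1 y) (G.rel y p.2.1)) (⋃ y, conj (F.rel p.1 y) (G.rel y p.2.2)))
        fun p => Z.eq p.2.1 p.2.2 := by
      refine Ent.exE (Ent.refl _).fst (Ent.exE (Ent.refl _).fst.snd ?_)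
      have h1 := (Ent.refl (A' := A') fun p : ((X.carrier × Z.carrier × Z.carrier) × Y.carrier) ×
        Y.carrier => conj (conj (conj (⋃ y, conj (F.rel p.1.1.1 y) (G.rel y p.1.1.2.1))
          (⋃ y, conj (F.rel p.1.1.1 y) (G.rel y p.1.1.2.2)))
          (conj (F.rel p.1.1.1 p.1.2) (G.rel p.1.2 p.1.1.2.1)))
          (conj (F.rel p.1.1.1 p.2) (G.rel p.2 p.1.1.2.2)))
      have hy := F.ent_single h1.fst.snd.fst h1.snd.fst
      exact G.ent_single (G.ent_ext h1.fst.snd.snd hy (G.ent_cod h1.fst.snd.snd)) h1.snd.snd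
    simpa [Ent, Holds] using h
  total := by
    have h : Ent A' (fun x : X.carrier => X.eq x x)
        fun x => ⋃ z, ⋃ y, conj (F.rel x y) (G.rel y z) := by
      refine Ent.exE (F.ent_total (Ent.refl _)) (Ent.exE (G.ent_total (F.ent_cod (Ent.refl _).snd)) ?_)
      refine Ent.exI Prod.snd (Ent.exI (fun p => p.1.2) ?_)
      exact (Ent.refl _).fst.snd.pair (Ent.refl _).snd
    exact h

theorem compRel_mono {F F' : FunRel X Y} {G G' : FunRel Y Z} (hF : RelLE F F') (hG : RelLE G G') :
    RelLE (compRel F G) (compRel F' G') := by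
  refine relLE_iff.2 (Ent.exE (Ent.refl _) (Ent.exI Prod.snd ?_))
  exact (hF.ent (Ent.refl _).snd.fst).pair (hG.ent (Ent.refl _).snd.snd)

/-- The relative realizability topos as a category: morphisms are equivalence classes of
functional relations. -/
instance category : Category.{u} (RT A') where
  Hom X Y := Quotient (relSetoid X Y)
  id X := Quotient.mk _ (idRel X)
  comp f g := Quotient.map₂ compRel
    (fun F F' (h : RelLE F F' ∧ RelLE F' F) G G' (h' : RelLE G G' ∧ RelLE G' G) =>
      (⟨compRel_mono h.1 h'.1, compRel_mono h.2 h'.2⟩ :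
        RelLE (compRel F G) (compRel F' G') ∧ RelLE (compRel F' G') (compRel F G))) f g
  id_comp := by
    rintro X Y ⟨F⟩
    refine Quotient.sound ⟨relLE_iff.2 ?_, relLE_iff.2 ?_⟩
    · refine Ent.exE (Ent.refl _) ?_
      have h := (Ent.refl (A' := A') fun p : (X.carrier × Y.carrier) × X.carrier =>
        conj (⋃ y, conj (X.eq p.1.1 y) (F.rel y p.1.2)) (conj (X.eq p.1.1 p.2) (F.rel p.2 p.1.2)))
      exact F.ent_ext h.snd.snd (X.ent_symm h.snd.fst) (F.ent_cod h.snd.snd)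
    · exact Ent.exI Prod.fst ((F.ent_dom (Ent.refl _)).pair (Ent.refl _))
  comp_id := by
    rintro X Y ⟨F⟩
    refine Quotient.sound ⟨relLE_iff.2 ?_, relLE_iff.2 ?_⟩
    · refine Ent.exE (Ent.refl _) ?_
      have h := (Ent.refl (A' := A') fun p : (X.carrier × Y.carrier) × Y.carrier =>
        conj (⋃ y, conj (F.rel p.1.1 y) (Y.eq y p.1.2)) (conj (F.rel p.1.1 p.2) (Y.eq p.2 p.1.2)))
      exact F.ent_ext h.snd.fst (F.ent_dom h.snd.fst) h.snd.snd
    · exact Ent.exI Prod.snd ((Ent.refl _).pair (F.ent_cod (Ent.refl _)))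
  assoc := by
    rintro X Y Z W ⟨F⟩ ⟨G⟩ ⟨H⟩
    refine Quotient.sound ⟨relLE_iff.2 ?_, relLE_iff.2 ?_⟩
    · refine Ent.exE (Ent.refl _) (Ent.exE (Ent.refl _).snd.fst ?_)
      refine Ent.exI Prod.snd ((Ent.refl _).snd.fst.pair (Ent.exI (fun p => p.1.2) ?_))
      exact (Ent.refl _).snd.snd.pair (Ent.refl _).fst.snd.snd
    · refine Ent.exE (Ent.refl _) (Ent.exE (Ent.refl _).snd.snd ?_)
      refine Ent.exI Prod.snd (Ent.pair (Ent.exI (fun p => p.1.2) ?_) (Ent.refl _).snd.snd)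
      exact (Ent.refl _).fst.snd.fst.pair (Ent.refl _).snd.fst

/-! ### Truth values and predicates -/

theorem ent_equ_symm {φ ψ : I → Set A} (h : Ent A' Γ fun i => equ (φ i) (ψ i)) :
    Ent A' Γ fun i => equ (ψ i) (φ i) :=
  h.snd.pair h.fst

theorem ent_equ_trans {φ ψ χ : I → Set A} (h : Ent A' Γ fun i => equ (φ i) (ψ i))
    (h' : Ent A' Γ fun i => equ (ψ i) (χ i)) : Ent A' Γ fun i => equ (φ i) (χ i) := by
  refine Ent.pair (Ent.intro ?_) (Ent.intro ?_)
  · exact ((Ent.refl _).fst.trans h'.fst).mp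
      (((Ent.refl _).fst.trans h.fst).mp (Ent.refl _).snd)
  · exact ((Ent.refl _).fst.trans h.snd).mp
      (((Ent.refl _).fst.trans h'.snd).mp (Ent.refl _).snd)

theorem ent_equ_refl (φ : I → Set A) : Ent A' Γ fun i => equ (φ i) (φ i) :=
  Ent.pair (Ent.intro (Ent.refl _).snd) (Ent.intro (Ent.refl _).snd)

variable (A') in
/-- The object of truth values `Ω`: all subsets of `A`, with equivalence as equality. -/
def Omega : RT A' where
  carrier := Set A
  eq := equ
  symm := by
    have h : Ent A' (fun p : Set A × Set A => equ p.1 p.2) fun p => equ p.2 p.1 :=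
      ent_equ_symm (Ent.refl _)
    simpa [Ent, Holds] using h
  trans := by
    have h : Ent A' (fun p : Set A × Set A × Set A => conj (equ p.1 p.2.1) (equ p.2.1 p.2.2))
        fun p => equ p.1 p.2.2 :=
      ent_equ_trans (Ent.refl _).fst (Ent.refl _).snd
    simpa [Ent, Holds] using h

/-- A map from the underlying set of `X` to truth values is extensional if it respects the equality
of `X`. -/
def Extensional (X : RT A') (φ : X.carrier → Set A) : Prop :=
  Holds A' (⋂ x, ⋂ x', imp (conj (φ x) (X.eq x x')) (φ x'))

theorem Extensional.ent {φ : X.carrier → Set A} (hφ : Extensional X φ) {x x' : I → X.carrier}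
    (h : Ent A' Γ fun i => φ (x i)) (h' : Ent A' Γ fun i => X.eq (x i) (x' i)) :
    Ent A' Γ fun i => φ (x' i) := by
  refine (h.pair h').trans ?_
  obtain ⟨a, ha, h⟩ := hφ
  simp only [Set.mem_iInter] at h
  exact ⟨a, ha, Set.mem_iInter.2 fun i => h _ _⟩

theorem Extensional.ent_equ {φ : X.carrier → Set A} (hφ : Extensional X φ) {x x' : I → X.carrier}
    (h : Ent A' Γ fun i => X.eq (x i) (x' i)) : Ent A' Γ fun i => equ (φ (x i)) (φ (x' i)) :=
  Ent.pair (Ent.intro (hφ.ent (Ent.refl _).snd ((Ent.refl _).fst.trans h)))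
    (Ent.intro (hφ.ent (Ent.refl _).snd ((Ent.refl _).fst.trans (X.ent_symm h))))

/-- The functional relation from `X` to `Ω` that represents an extensional map `φ`. -/
def chiRel (X : RT A') (φ : X.carrier → Set A) (hφ : Extensional X φ) : FunRel X (Omega A') where
  rel x p := conj (X.eq x x) (equ (φ x) p)
  strict := by
    have h : Ent A' (fun q : X.carrier × Set A => conj (X.eq q.1 q.1) (equ (φ q.1) q.2))
        fun q => conj (X.eq q.1 q.1) (equ q.2 q.2) :=
      (Ent.refl _).fst.pair (ent_equ_refl _)
    simpa [Ent, Holds, Omega] using h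
  ext := by
    have h : Ent A' (fun q : X.carrier × X.carrier × Set A × Set A =>
        conj (conj (X.eq q.1 q.1) (equ (φ q.1) q.2.2.1))
          (conj (X.eq q.1 q.2.1) (equ q.2.2.1 q.2.2.2)))
        fun q => conj (X.eq q.2.1 q.2.1) (equ (φ q.2.1) q.2.2.2) := by
      have h := Ent.refl (A' := A') (fun q : X.carrier × X.carrier × Set A × Set A =>
        conj (conj (X.eq q.1 q.1) (equ (φ q.1) q.2.2.1))
          (conj (X.eq q.1 q.2.1) (equ q.2.2.1 q.2.2.2)))
      exact (X.ent_left (X.ent_symm h.snd.fst)).pair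
        (ent_equ_trans (ent_equ_symm (hφ.ent_equ h.snd.fst)) (ent_equ_trans h.fst.snd h.snd.snd))
    simpa [Ent, Holds, Omega] using h
  single := by
    have h : Ent A' (fun q : X.carrier × Set A × Set A =>
        conj (conj (X.eq q.1 q.1) (equ (φ q.1) q.2.1)) (conj (X.eq q.1 q.1) (equ (φ q.1) q.2.2)))
        fun q => equ q.2.1 q.2.2 :=
      ent_equ_trans (ent_equ_symm (Ent.refl _).fst.snd) (Ent.refl _).snd.snd
    simpa [Ent, Holds, Omega] using h
  total := by
    have h : Ent A' (fun x : X.carrier => X.eq x x)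
        fun x => ⋃ p, conj (X.eq x x) (equ (φ x) p) :=
      Ent.exI φ ((Ent.refl _).pair (ent_equ_refl _))
    exact h

/-- The morphism `X ⟶ Ω`, that is the predicate on `X`, given by an extensional map. -/
def chi (X : RT A') (φ : X.carrier → Set A) (hφ : Extensional X φ) : X ⟶ Omega A' :=
  Quotient.mk (relSetoid X (Omega A')) (chiRel X φ hφ)

theorem extensional_univ (X : RT A') : Extensional X fun _ => Set.univ := by
  refine ⟨PCA.iE, iE_mem, ?_⟩
  simp only [Set.mem_iInter]
  exact fun _ _ d _ => ⟨d, by simp, trivial⟩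

/-- The predicate `true` on `X`. -/
def tru (X : RT A') : X ⟶ Omega A' := chi X (fun _ => Set.univ) (extensional_univ X)

/-- The truth value `p` at stage `X` is forced, `X ⊩ p`: it equals `true`. -/
def Forces (p : X ⟶ Omega A') : Prop := p = tru X

/-- The order on predicates on `X`, that is the internal implication `p ⇒ q` at stage `X`: every
generalized element that forces `p` forces `q`. -/
def PredLE (p q : X ⟶ Omega A') : Prop :=
  ∀ ⦃Y : RT A'⦄ (f : Y ⟶ X), Forces (f ≫ p) → Forces (f ≫ q)

/-- A Lawvere–Tierney topology: a map `j : Ω ⟶ Ω` that is internally monotone, inflationary and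
idempotent, where the quantifiers over truth values range over all stages. -/
structure IsLawvereTierney (j : Omega A' ⟶ Omega A') : Prop where
  monotone : ∀ (X : RT A') (p q : X ⟶ Omega A'), PredLE p q → PredLE (p ≫ j) (q ≫ j)
  inflationary : ∀ (X : RT A') (p : X ⟶ Omega A'), PredLE p (p ≫ j)
  idempotent : ∀ (X : RT A') (p : X ⟶ Omega A'), PredLE ((p ≫ j) ≫ j) (p ≫ j)

/-- `j` is the oracle modality for the predicate `P` on `X`: at all stages `Y`, and for all truth
values `s` at `Y`, `s ≫ j` is the truth value inductively generated by `s ⇒ O s` and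
`∀ a : X, (P a ⇒ O s) ⇒ O s`. -/
structure IsOracleModality (P : X ⟶ Omega A') (j : Omega A' ⟶ Omega A') : Prop where
  prf : ∀ (Y : RT A') (s : Y ⟶ Omega A'), PredLE s (s ≫ j)
  ask : ∀ (Y : RT A') (s : Y ⟶ Omega A') (a : Y ⟶ X), PredLE (a ≫ P) (s ≫ j) → Forces (s ≫ j)
  ind : ∀ (Y : RT A') (s r : Y ⟶ Omega A'), PredLE s r →
    (∀ (Z : RT A') (g : Z ⟶ Y) (a : Z ⟶ X), PredLE (a ≫ P) (g ≫ r) → Forces (g ≫ r)) →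
    PredLE (s ≫ j) r

/-- The morphism `j : Ω ⟶ Ω` is represented by the map `J` on subsets of `A`. -/
def Represents (J : Set A → Set A) (j : Omega A' ⟶ Omega A') : Prop :=
  ∃ hJ : Extensional (Omega A') J, j = chi (Omega A') J hJ

end Construction

end RT

/-! ### Partitioned assemblies and the explicit formulas -/

/-- A partitioned assembly: a set with a single realizer for each element. -/
structure PartitionedAssembly (A : Type u) : Type (u + 1) where
  /-- the underlying set -/
  carrier : Type u
  /-- the realizer of an element -/
  rho : carrier → A

namespace PartitionedAssembly

section Formula

variable {A : Type u} [PCA A]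

/-- A partitioned assembly as an object of the topos: `x` and `x'` are equal with realizer `a`
if `x = x'` and `a = ρ x`. -/
def toRT (A' : ElementarySubPCA A) (X : PartitionedAssembly A) : RT A' where
  carrier := X.carrier
  eq x x' := {a | x = x' ∧ a = X.rho x}
  symm := by
    refine ⟨PCA.iE, iE_mem, ?_⟩
    simp only [Set.mem_iInter]
    rintro x _ _ ⟨rfl, rfl⟩
    exact ⟨_, by simp, rfl, rfl⟩
  trans := by
    have h : Ent A' (fun p : X.carrier × X.carrier × X.carrier =>
        conj {a | p.1 = p.2.1 ∧ a = X.rho p.1} {a | p.2.1 = p.2.2 ∧ a = X.rho p.2.1})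
        fun p => {a | p.1 = p.2.2 ∧ a = X.rho p.1} := by
      obtain ⟨e, he, h⟩ := ent_iff.1 (Ent.refl (A' := A') (fun p : X.carrier × X.carrier × X.carrier =>
        conj {a | p.1 = p.2.1 ∧ a = X.rho p.1} {a | p.2.1 = p.2.2 ∧ a = X.rho p.2.1})).fst
      refine ent_iff.2 ⟨e, he, fun p d hd => ?_⟩
      obtain ⟨c, hc, h1, h2⟩ := h p d hd
      obtain ⟨_, _, _, ⟨h3, _⟩, _⟩ := hd
      exact ⟨c, hc, h1.trans h3, h2⟩
    obtain ⟨a, ha, h⟩ := h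
    refine ⟨a, ha, ?_⟩
    simp only [Set.mem_iInter] at h ⊢
    exact fun x y z => h (x, y, z)

theorem extensional (A' : ElementarySubPCA A) (X : PartitionedAssembly A) (P : X.carrier → Set A) :
    RT.Extensional (X.toRT A') P := by
  have h : Ent A' (fun p : X.carrier × X.carrier =>
      conj (P p.1) {a | p.1 = p.2 ∧ a = X.rho p.1}) fun p => P p.2 := by
    obtain ⟨e, he, h⟩ := ent_iff.1 (Ent.refl (A' := A') (fun p : X.carrier × X.carrier =>
      conj (P p.1) {a | p.1 = p.2 ∧ a = X.rho p.1})).fst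
    refine ent_iff.2 ⟨e, he, fun p d hd => ?_⟩
    obtain ⟨c, hc, h1⟩ := h p d hd
    obtain ⟨_, _, _, ⟨h3, _⟩, _⟩ := hd
    exact ⟨c, hc, h3 ▸ h1⟩
  obtain ⟨a, ha, h⟩ := h
  refine ⟨a, ha, ?_⟩
  simp only [Set.mem_iInter] at h ⊢
  exact fun x y => h (x, y)

/-- The predicate in the topos given by a map `P` from a partitioned assembly to subsets of `A`. -/
def predicate (A' : ElementarySubPCA A) (X : PartitionedAssembly A) (P : X.carrier → Set A) :
    X.toRT A' ⟶ RT.Omega A' :=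
  RT.chi (X.toRT A') P (X.extensional A' P)

end Formula

end PartitionedAssembly

section OracleFormulas

variable {A : Type u} [PCA A]

open PCA in
/-- The least solution `T` of
`T = {⟨0, a⟩ | a ∈ S} ∪ ⋃ x, {⟨1, ⟨ρ x, c⟩⟩ | ∀ d ∈ P x, c d is defined and c d ∈ T}`. -/
def oracleAsm (X : PartitionedAssembly A) (P : X.carrier → Set A) (S : Set A) : Set A :=
  OrderHom.lfp
    { toFun := fun T => {e | ∃ a ∈ S, e = pair (numeral 0) a} ∪
        ⋃ x : X.carrier, {e | ∃ c : A, (∀ d ∈ P x, ∃ y ∈ app c d, y ∈ T) ∧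
          e = pair (numeral 1) (pair (X.rho x) c)}
      monotone' := by
        intro T T' hT
        refine Set.union_subset_union_right _ (Set.iUnion_mono fun x => ?_)
        rintro e ⟨c, hc, rfl⟩
        refine ⟨c, fun d hd => ?_, rfl⟩
        obtain ⟨y, hy, hyT⟩ := hc d hd
        exact ⟨y, hy, hT hyT⟩ }

open PCA in
/-- For an extended Weihrauch predicate `f`, the least solution `T` of
`T = {⟨0, a⟩ | a ∈ S} ∪ ⋃ b, ⋃ θ ∈ f b, {⟨1, b, c⟩ | ∀ d ∈ θ, c d is defined and c d ∈ T}`,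
where `⟨1, b, c⟩` is the nested pair `⟨1, ⟨b, c⟩⟩`. -/
def oracleWeihrauch (f : A → Set (Set A)) (S : Set A) : Set A :=
  OrderHom.lfp
    { toFun := fun T => {e | ∃ a ∈ S, e = pair (numeral 0) a} ∪
        ⋃ b : A, ⋃ θ ∈ f b, {e | ∃ c : A, (∀ d ∈ θ, ∃ y ∈ app c d, y ∈ T) ∧
          e = pair (numeral 1) (pair b c)}
      monotone' := by
        intro T T' hT
        refine Set.union_subset_union_right _ (Set.iUnion_mono fun b => Set.iUnion₂_mono fun θ _ => ?_)
        rintro e ⟨c, hc, rfl⟩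
        refine ⟨c, fun d hd => ?_, rfl⟩
        obtain ⟨y, hy, hyT⟩ := hc d hd
        exact ⟨y, hy, hT hyT⟩ }

end OracleFormulas

/-! Morphisms into `Ω` are given by extensional maps into subsets of `A` (`exists_eq_chi`), so a
topology is a map `J` for which monotonicity, inflation and idempotence have realizers in `A'`,
uniform in the truth values. To read these realizers off from conditions quantified over all stages,
one evaluates at a generic stage: the object `diag` whose existence predicate is the hypothesis.
There forcing is exactly entailment (`forces_diagChi_iff`, `predLE_diagChi_iff`).

Given a topology `J`, let the points of a partitioned assembly be the pairs `(a, S)` with `a ∈ J S`,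
with `a` as realizer and `S` as the value of the predicate. Asking the question `(a, S)` turns the
realizer `a` of `J S` into one of the oracle truth value of `S`. Conversely a dialogue tree
collapses to `J` by recursion: leaves by inflation, nodes by monotonicity followed by idempotence
(`represents_of_isLawvereTierney`).

For the other direction the least solution must satisfy the rules of an inductive type inside the
logic. The constructors are immediate. The eliminator needs one realizer in `A'` for all `S` and
`R`; the recursion theorem supplies it, and induction over the least fixed point shows that it
terminates correctly (`ent_oracleAsm_elim`). The topology axioms and the universal property of the
oracle modality follow. The Weihrauch formula is the same operator with the points indexed
differently, so the two least solutions are equal sets. -/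

namespace Rz

open PCA

/-! ### Programming in a partial combinatory algebra -/

section Recursion

variable {A : Type u} [PCA A] {A' : ElementarySubPCA A}

/-- The first projection of pairs, as a strict partial function. -/
def fstP (x : Part A) : Part A := ap x (Part.some k)

/-- The second projection of pairs, as a strict partial function. -/
def sndP (x : Part A) : Part A := ap x (Part.some (kE iE))

/-- Strict pairing of partial elements. -/
def pairP (x y : Part A) : Part A := x.bind fun u => y.bind fun v => Part.some (PCA.pair u v)

@[simp] theorem fstP_pair (a b : A) : fstP (Part.some (PCA.pair a b)) = Part.some a := by
  simp [fstP, ap_some, app_pair, some_kE]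

@[simp] theorem sndP_pair (a b : A) : sndP (Part.some (PCA.pair a b)) = Part.some b := by
  simp [sndP, ap_some, app_pair]

@[simp] theorem pairP_some (a b : A) :
    pairP (Part.some a) (Part.some b) = Part.some (PCA.pair a b) := by
  simp [pairP]

theorem Tracked.fstP {f : A → Part A} (hf : Tracked A' f) : Tracked A' fun x => fstP (f x) :=
  hf.ap (tracked_const A'.k_mem)

theorem Tracked.sndP {f : A → Part A} (hf : Tracked A' f) : Tracked A' fun x => sndP (f x) :=
  hf.ap (tracked_const (kE_mem iE_mem))

theorem Tracked.pairP {f g : A → Part A} (hf : Tracked A' f) (hg : Tracked A' g) :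
    Tracked A' fun x => pairP (f x) (g x) :=
  hf.pair hg

theorem Tracked.bind {f F : A → Part A} (hF : Tracked A' F) (hf : Tracked A' f) :
    Tracked A' fun x => (f x).bind F := by
  obtain ⟨e, he, hF⟩ := hF
  obtain rfl : app e = F := funext hF
  simpa [PCA.ap] using (tracked_const he).ap hf

/-- The code `c x` is a combinator term that postpones running `F` until `d` arrives, so it is
defined even where `F` is not. The equation is a Kleene equality, which lets `F` diverge and makes
self-reference possible. -/
theorem Tracked.curry {F : A → Part A} (hF : Tracked A' F) :
    ∃ c : A → A, Tracked A' (fun x => Part.some (c x)) ∧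
      ∀ x d, app (c x) d = F (PCA.pair x d) := by
  obtain ⟨e, he, hF⟩ := hF
  obtain ⟨w, hw⟩ : ∃ w : A → A, ∀ x, app s (PCA.sE PCA.iE (PCA.kE x)) = Part.some (w x) :=
    ⟨_, fun x => (Part.some_get (s_dom_one _)).symm⟩
  refine ⟨fun x => PCA.sE (PCA.kE e) (PCA.sE (PCA.kE (w x)) k), ?_, fun x d => ?_⟩
  · have t := (tracked_const (kE_mem he)).sE
      ((((tracked_const A'.s_mem).ap ((tracked_const iE_mem).sE tracked_id.kE)).kE).sE
        (tracked_const A'.k_mem))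
    convert t using 2 with x
    simp [PCA.ap, hw]
  · have hq : app (w x) (PCA.kE d) = Part.some (PCA.pair x d) := by
      have := some_sE (PCA.sE PCA.iE (PCA.kE x)) (PCA.kE d)
      rwa [hw x, Part.bind_some] at this
    simp [app_sE, some_kE, hq, hF]

/-- The recursion theorem: a tracked function has access to an index of itself. -/
theorem Tracked.recursion {F : A → Part A} (hF : Tracked A' F) :
    ∃ e ∈ A'.carrier, ∀ x, app e x = F (PCA.pair e x) := by
  -- Diagonalization: `c x` applied to `y` is `F ⟨x x, y⟩`, and `d` computes `c`. Hence `c d` is the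
  -- value of `d d`, which is the index sought.
  obtain ⟨c, ⟨d, hd, hc⟩, hcF⟩ := (hF.bind ((tracked_id.fstP.ap tracked_id.fstP).pairP
    tracked_id.sndP)).curry
  refine ⟨c d, A'.app_mem d hd d hd _ (by simp [hc]), fun x => ?_⟩
  simp [hcF, ap_some, hc]

/-- Definition by cases on the numerals `0` and `1`. -/
theorem Tracked.cases {t f g : A → Part A} (ht : Tracked A' t) (hf : Tracked A' f)
    (hg : Tracked A' g) : ∃ H, Tracked A' H ∧
      (∀ w, t w = Part.some (numeral 0) → H w = f w) ∧
      ∀ w, t w = Part.some (numeral 1) → H w = g w := by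
  obtain ⟨e, he, hf⟩ := hf
  obtain ⟨e', he', hg⟩ := hg
  -- The numeral first selects one of the codes `e` and `e'`, and only the selected one is run on
  -- `w`. The branch not taken may therefore diverge.
  refine ⟨_, (((ht.ap (tracked_const A'.k_mem)).ap (tracked_const he)).ap
    (tracked_const he')).ap tracked_id, fun w hw => ?_, fun w hw => ?_⟩
  · simp [hw, ap_some, numeral, some_kE, hf]
  · simp [hw, ap_some, numeral, app_pair, some_kE, hg]

theorem numeral_mem (n : ℕ) : (numeral n : A) ∈ A'.carrier := by
  induction n with
  | zero => exact iE_mem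
  | succ n ih => exact sE_mem (sE_mem iE_mem (kE_mem (kE_mem iE_mem))) (kE_mem ih)

end Recursion

/-! ### Universal quantification and weakening -/

section Quantifiers

variable {A : Type u} [PCA A] {A' : ElementarySubPCA A} {I J : Type*}

theorem Ent.allI {Γ : I → Set A} {φ ψ : I → J → Set A}
    (h : Ent A' (fun p : I × J => conj (Γ p.1) (φ p.1 p.2)) fun p => ψ p.1 p.2) :
    Ent A' Γ fun i => ⋂ j, imp (φ i j) (ψ i j) := by
  obtain ⟨e, he, h⟩ := ent_iff.1 h
  obtain ⟨c, ⟨e', he', hc⟩, hcF⟩ := Tracked.curry (A' := A') ⟨e, he, fun _ => rfl⟩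
  refine ent_iff.2 ⟨e', he', fun i d hd => ⟨c d, by simp [hc], Set.mem_iInter.2 fun j x hx => ?_⟩⟩
  rw [hcF]
  exact h (i, j) _ ⟨d, hd, x, hx, rfl⟩

theorem Ent.weaken {Γ φ : I → Set A} {ψ : Set A} (hψ : Holds A' ψ) (h : ∀ i, ψ ⊆ φ i) :
    Ent A' Γ φ := by
  obtain ⟨a, ha, haψ⟩ := hψ
  exact ent_iff.2 ⟨_, kE_mem ha, fun i d _ => ⟨a, by simp, h i haψ⟩⟩

end Quantifiers

end Rz

/-! ### Realized introduction and elimination rules for the least solution -/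

namespace PartitionedAssembly

open PCA Rz

section Rules

variable {A : Type u} [PCA A] {A' : ElementarySubPCA A} {I : Type*} {Γ : I → Set A}
  (X : PartitionedAssembly A) (P : X.carrier → Set A)

theorem oracleAsm_eq (S : Set A) : oracleAsm X P S =
    {e | ∃ a ∈ S, e = PCA.pair (numeral 0) a} ∪
      ⋃ x : X.carrier, {e | ∃ c : A, (∀ d ∈ P x, ∃ y ∈ app c d, y ∈ oracleAsm X P S) ∧
        e = PCA.pair (numeral 1) (PCA.pair (X.rho x) c)} :=
  (OrderHom.map_lfp _).symm

theorem oracleAsm_subset {S T : Set A} (h0 : ∀ a ∈ S, PCA.pair (numeral 0) a ∈ T)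
    (h1 : ∀ x c, (∀ d ∈ P x, ∃ y ∈ app c d, y ∈ T) →
      PCA.pair (numeral 1) (PCA.pair (X.rho x) c) ∈ T) : oracleAsm X P S ⊆ T := by
  refine OrderHom.lfp_le _ ?_
  rintro e (⟨a, ha, rfl⟩ | he)
  · exact h0 a ha
  · obtain ⟨x, c, hc, rfl⟩ := Set.mem_iUnion.1 he
    exact h1 x c hc

theorem ent_oracleAsm_unit (S : I → Set A) : Ent A' S fun i => oracleAsm X P (S i) := by
  obtain ⟨e, he, h⟩ := (tracked_const (numeral_mem (A' := A') 0)).pairP tracked_id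
  refine ent_iff.2 ⟨e, he, fun i a ha => ⟨PCA.pair (numeral 0) a, by simp [h], ?_⟩⟩
  rw [oracleAsm_eq]
  exact Or.inl ⟨a, ha, rfl⟩

/-- A realizer of the premise already has the shape `⟨ρ x, c⟩` required in the second clause, so
attaching the tag `1` suffices. -/
theorem ent_oracleAsm_ask (S : I → Set A) (x : I → X.carrier) :
    Ent A' (fun i => conj {X.rho (x i)} (imp (P (x i)) (oracleAsm X P (S i))))
      fun i => oracleAsm X P (S i) := by
  obtain ⟨e, he, h⟩ := (tracked_const (numeral_mem (A' := A') 1)).pairP tracked_id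
  refine ent_iff.2 ⟨e, he, ?_⟩
  rintro i _ ⟨_, rfl, c, hc, rfl⟩
  refine ⟨PCA.pair (numeral 1) (PCA.pair (X.rho (x i)) c), by simp [h], ?_⟩
  rw [oracleAsm_eq]
  exact Or.inr (Set.mem_iUnion.2 ⟨x i, c, hc, rfl⟩)

/-- The universal property of the least solution, with a realizer that works for all `S` and `R`. -/
theorem ent_oracleAsm_elim (S R : I → Set A) :
    Ent A' (fun i => conj (conj (imp (S i) (R i))
        (⋂ x, imp (conj {X.rho x} (imp (P x) (R i))) (R i))) (oracleAsm X P (S i))) R := by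
  have hself := (tracked_id (A' := A')).fstP
  have hctx := (tracked_id (A' := A')).sndP.fstP
  have harg := (tracked_id (A' := A')).sndP.sndP
  -- The input is `⟨e, ⟨⟨h, q⟩, o⟩⟩`, where `e` is the program's own index. When `o` is a node `⟨1,
  -- ⟨ρ x, v⟩⟩`, the code `c` is the recursive call that sends `d` to `e ⟨⟨h, q⟩, v d⟩`.
  obtain ⟨c, hc, hcF⟩ := (hself.fstP.ap
    (hctx.bind hself |>.pairP ((harg.sndP.sndP.bind hself).ap tracked_id.sndP))).curry
  -- A leaf `⟨0, a⟩` returns `h a`; a node returns `q` applied to `ρ x` paired with the recursive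
  -- call.
  obtain ⟨H, hH, h0, h1⟩ := harg.fstP.cases (hctx.fstP.ap harg.sndP)
    (hctx.sndP.ap (harg.sndP.fstP.pairP hc))
  obtain ⟨e, he, hrec⟩ := hH.recursion
  refine ent_iff.2 ⟨e, he, ?_⟩
  rintro i _ ⟨_, ⟨h, hh, q, hq, rfl⟩, o, ho, rfl⟩
  -- Termination and correctness are proved together: the inputs on which `e` is defined with value
  -- in `R i` are closed under both clauses.
  refine oracleAsm_subset X P
    (T := {o | ∃ y ∈ app e (PCA.pair (PCA.pair h q) o), y ∈ R i}) ?_ ?_ ho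
  · intro a ha
    rw [Set.mem_ofPred_eq, hrec, h0 _ (by simp)]
    simpa [ap_some] using hh a ha
  · intro x v hv
    rw [Set.mem_ofPred_eq, hrec, h1 _ (by simp)]
    simp only [sndP_pair, fstP_pair, pairP_some, ap_some]
    refine Set.mem_iInter.1 hq x _ ⟨_, rfl, _, fun d hd => ?_, rfl⟩
    obtain ⟨y, hy, r, hr, hrR⟩ := hv d hd
    refine ⟨r, ?_, hrR⟩
    rw [hcF]
    simpa [ap_some, Part.eq_some_iff.2 hy] using hr

end Rules

end PartitionedAssembly

/-! ### Predicates as extensional maps -/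

namespace RT

open Rz

section Predicates

variable {A : Type u} [PCA A] {A' : ElementarySubPCA A} {I : Type*} {Γ : I → Set A}
  {X Y Z : RT A'}

theorem extensional_of_ent {φ : X.carrier → Set A}
    (h : Ent A' (fun p : X.carrier × X.carrier => conj (φ p.1) (X.eq p.1 p.2)) fun p => φ p.2) :
    Extensional X φ := by
  simpa [Ent, Extensional, Holds] using h

/-- Every morphism to the object of truth values is given by an extensional map. -/
theorem exists_eq_chi (f : X ⟶ Omega A') :
    ∃ (φ : X.carrier → Set A) (hφ : Extensional X φ), f = chi X φ hφ := by
  obtain ⟨F, rfl⟩ := Quotient.exists_rep f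
  -- The map sends `x` to "the value of `F` at `x` holds". No value has to be chosen, and since `F`
  -- is single valued this truth value is equivalent to any `p` related to `x`.
  have hφ : Extensional X fun x => ⋃ p : Set A, conj (F.rel x p) p := by
    refine extensional_of_ent (Ent.exE (Ent.refl _).fst (Ent.exI Prod.snd ?_))
    exact (F.ent_ext (Ent.refl _).snd.fst (Ent.refl _).fst.snd
      (F.ent_cod (Ent.refl _).snd.fst)).pair (Ent.refl _).snd.snd
  refine ⟨_, hφ, Quotient.sound ⟨relLE_iff.2 ?_, relLE_iff.2 ?_⟩⟩
  · refine (F.ent_dom (Ent.refl _)).pair (Ent.pair (Ent.intro ?_) (Ent.intro ?_))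
    · refine Ent.exE (Ent.refl _).snd (Ent.mp (φ := fun p => p.2) ?_ (Ent.refl _).snd.snd)
      exact (F.ent_single (Ent.refl _).snd.fst (Ent.refl _).fst.fst).fst
    · exact Ent.exI Prod.snd (Ent.refl _)
  · refine Ent.exE (F.ent_total (Ent.refl _).fst) (F.ent_ext (Ent.refl _).snd
      (Ent.refl _).fst.fst ?_)
    refine ent_equ_trans (Ent.pair (Ent.intro ?_) (Ent.intro ?_)) (Ent.refl _).fst.snd
    · exact Ent.exI (fun p => p.2) ((Ent.refl _).fst.snd.pair (Ent.refl _).snd)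
    · refine Ent.exE (Ent.refl _).snd (Ent.mp (φ := fun p => p.2) ?_ (Ent.refl _).snd.snd)
      exact (F.ent_single (Ent.refl _).snd.fst (Ent.refl _).fst.fst.snd).fst


theorem chi_eq_iff {φ ψ : X.carrier → Set A} {hφ : Extensional X φ} {hψ : Extensional X ψ} :
    chi X φ hφ = chi X ψ hψ ↔
      Ent A' (fun x => X.eq x x) fun x => equ (φ x) (ψ x) := by
  constructor
  · intro h
    have h := (Quotient.exact h).1
    refine ent_equ_symm (Ent.snd (φ := fun x => X.eq x x) ?_)
    exact ((Ent.refl _).pair (ent_equ_refl _)).trans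
      -- Evaluating the inclusion of graphs at the actual value `φ x` gives the equivalence.
      ((relLE_iff.1 h).comap fun x : X.carrier => (x, φ x))
  · intro h
    have h' : Ent A' (fun p : X.carrier × Set A => X.eq p.1 p.1)
      fun p => equ (φ p.1) (ψ p.1) := h.comap Prod.fst
    refine Quotient.sound ⟨relLE_iff.2 ?_, relLE_iff.2 ?_⟩
    · exact (Ent.refl _).fst.pair
        (ent_equ_trans (ent_equ_symm ((Ent.refl _).fst.trans h')) (Ent.refl _).snd)
    · exact (Ent.refl _).fst.pair (ent_equ_trans ((Ent.refl _).fst.trans h') (Ent.refl _).snd)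

/-- The combinator `k` realizes the full subset, so equivalence with truth amounts to `φ` being
realized. -/
theorem forces_chi_iff {φ : X.carrier → Set A} {hφ : Extensional X φ} :
    Forces (chi X φ hφ) ↔ Ent A' (fun x => X.eq x x) φ := by
  refine chi_eq_iff.trans ⟨fun h => ?_, fun h => ?_⟩
  · exact h.snd.mp (Ent.weaken ⟨PCA.k, A'.k_mem, Set.mem_univ _⟩ fun _ => subset_rfl)
  · exact Ent.pair (Ent.intro (Ent.weaken ⟨PCA.k, A'.k_mem, Set.mem_univ _⟩ fun _ => subset_rfl))
      (Ent.intro ((Ent.refl _).fst.trans h))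

theorem extensional_pullback (F : FunRel Y X) {φ : X.carrier → Set A} :
    Extensional Y fun y => ⋃ x, conj (F.rel y x) (φ x) := by
  refine extensional_of_ent (Ent.exE (Ent.refl _).fst (Ent.exI Prod.snd ?_))
  exact (F.ent_ext (Ent.refl _).snd.fst (Ent.refl _).fst.snd
    (F.ent_cod (Ent.refl _).snd.fst)).pair (Ent.refl _).snd.snd

theorem mk_comp_chi (F : FunRel Y X) {φ : X.carrier → Set A} (hφ : Extensional X φ) :
    ((Quotient.mk _ F : Y ⟶ X) ≫ chi X φ hφ) =
      chi Y (fun y => ⋃ x, conj (F.rel y x) (φ x)) (extensional_pullback F) := by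
  refine Quotient.sound ⟨relLE_iff.2 ?_, relLE_iff.2 ?_⟩
  · refine Ent.exE (Ent.refl _) ((F.ent_dom (Ent.refl _).snd.fst).pair
      (Ent.pair (Ent.intro ?_) (Ent.intro ?_)))
    · refine Ent.exE (Ent.refl _).snd ?_
      refine (Ent.refl _).fst.fst.snd.snd.snd.fst.mp ?_
      exact hφ.ent (Ent.refl _).snd.snd
        (F.ent_single (Ent.refl _).snd.fst (Ent.refl _).fst.fst.snd.fst)
    · exact Ent.exI (fun p => p.2) ((Ent.refl _).fst.snd.fst.pair
        ((Ent.refl _).fst.snd.snd.snd.snd.mp (Ent.refl _).snd))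
  · refine Ent.exE (F.ent_total (Ent.refl _).fst) (Ent.exI Prod.snd ((Ent.refl _).snd.pair
      ((F.ent_cod (Ent.refl _).snd).pair (Ent.pair (Ent.intro ?_) (Ent.intro ?_)))))
    · exact (Ent.refl _).fst.fst.snd.fst.mp
        (Ent.exI (fun p => p.2) ((Ent.refl _).fst.snd.pair (Ent.refl _).snd))
    · refine Ent.exE ((Ent.refl _).fst.fst.snd.snd.mp (Ent.refl _).snd) ?_
      exact hφ.ent (Ent.refl _).snd.snd
        (F.ent_single (Ent.refl _).snd.fst (Ent.refl _).fst.fst.snd)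

theorem extensional_comp {J : Set A → Set A} (hJ : Extensional (Omega A') J) {φ : X.carrier → Set A}
    (hφ : Extensional X φ) : Extensional X fun x => J (φ x) :=
  extensional_of_ent (hJ.ent (x := fun p : X.carrier × X.carrier => φ p.1) (Ent.refl _).fst
    (hφ.ent_equ (Ent.refl _).snd))

theorem chi_comp_chi {J : Set A → Set A} (hJ : Extensional (Omega A') J) {φ : X.carrier → Set A}
    (hφ : Extensional X φ) :
    chi X φ hφ ≫ chi (Omega A') J hJ = chi X (fun x => J (φ x)) (extensional_comp hJ hφ) := by
  refine (mk_comp_chi (chiRel X φ hφ) hJ).trans (chi_eq_iff.2 ?_)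
  refine Ent.pair (Ent.intro ?_) (Ent.intro ?_)
  · exact Ent.exE (Ent.refl _).snd (hJ.ent (x := Prod.snd) (Ent.refl _).snd.snd
      (ent_equ_symm (Ent.refl _).snd.fst.snd))
  · exact Ent.exI φ (((Ent.refl _).fst.pair (ent_equ_refl _)).pair (Ent.refl _).snd)

end Predicates

/-! ### Generic stages: forcing as entailment -/

section Discrete

variable {A : Type u} [PCA A] {A' : ElementarySubPCA A} {I : Type*} {Γ : I → Set A}
  {K : Type u} {X Y : RT A'}

theorem ent_subst {L : Type*} {ε φ : L → Set A} {x y : I → L}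
    (h : Ent A' Γ fun i => {a | x i = y i ∧ a ∈ ε (x i)}) (h' : Ent A' Γ fun i => φ (x i)) :
    Ent A' Γ fun i => φ (y i) := by
  obtain ⟨_, _, h⟩ := ent_iff.1 h
  obtain ⟨e, he, h'⟩ := ent_iff.1 h'
  refine ent_iff.2 ⟨e, he, fun i d hd => ?_⟩
  -- The realizer of the equality is discarded: its mere existence makes the two points equal, so
  -- the realizer of `φ` is reused unchanged.
  obtain ⟨_, _, hxy, _⟩ := h i d hd
  exact hxy ▸ h' i d hd

/-- The object with diagonal equality and existence predicate `ε`. -/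
def diag (A' : ElementarySubPCA A) (ε : K → Set A) : RT A' where
  carrier := K
  eq x y := {a | x = y ∧ a ∈ ε x}
  symm := by
    refine ⟨PCA.iE, iE_mem, ?_⟩
    simp only [Set.mem_iInter]
    rintro x _ a ⟨rfl, ha⟩
    exact ⟨a, by simp, rfl, ha⟩
  trans := by
    have h : Ent A' (fun p : K × K × K =>
        conj {a | p.1 = p.2.1 ∧ a ∈ ε p.1} {a | p.2.1 = p.2.2 ∧ a ∈ ε p.2.1})
        fun p => {a | p.1 = p.2.2 ∧ a ∈ ε p.1} := by
      obtain ⟨e, he, h⟩ := ent_iff.1 (Ent.refl (A' := A') fun p : K × K × K =>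
        conj {a | p.1 = p.2.1 ∧ a ∈ ε p.1} {a | p.2.1 = p.2.2 ∧ a ∈ ε p.2.1}).fst
      refine ent_iff.2 ⟨e, he, fun p d hd => ?_⟩
      obtain ⟨c, hc, h1, h2⟩ := h p d hd
      obtain ⟨_, _, _, ⟨h3, _⟩, _⟩ := hd
      exact ⟨c, hc, h1.trans h3, h2⟩
    simpa [Ent, Holds] using h

theorem extensional_diag (ε φ : K → Set A) : Extensional (diag A' ε) φ :=
  extensional_of_ent (ent_subst (ε := ε) (x := Prod.fst) (y := Prod.snd)
    (Ent.refl _).snd (Ent.refl _).fst)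

/-- The functional relation given by a map out of an object with diagonal equality. -/
def diagRel (ε : K → Set A) (f : K → Y.carrier) (hf : Ent A' ε fun i => Y.eq (f i) (f i)) :
    FunRel (diag A' ε) Y where
  rel i y := conj (ε i) (Y.eq (f i) y)
  strict := by
    have h : Ent A' (fun p : K × Y.carrier => conj (ε p.1) (Y.eq (f p.1) p.2))
        fun p => conj {a | p.1 = p.1 ∧ a ∈ ε p.1} (Y.eq p.2 p.2) :=
      Ent.pair (by simpa using (Ent.refl _).fst) (Y.ent_left (Y.ent_symm (Ent.refl _).snd))
    simpa [Ent, Holds, diag] using h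
  ext := by
    have h : Ent A' (fun p : K × K × Y.carrier × Y.carrier =>
        conj (conj (ε p.1) (Y.eq (f p.1) p.2.2.1))
          (conj {a | p.1 = p.2.1 ∧ a ∈ ε p.1} (Y.eq p.2.2.1 p.2.2.2)))
        fun p => conj (ε p.2.1) (Y.eq (f p.2.1) p.2.2.2) := by
      refine (ent_subst (ε := ε) (Ent.refl _).snd.fst (Ent.refl _).fst.fst).pair
        (Y.ent_trans (Y.ent_symm ?_) (Ent.refl _).snd.snd)
      refine (ent_subst (φ := fun q : K × Y.carrier => Y.eq q.2 (f q.1))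
        (ε := fun q => ε q.1) (x := fun p : K × K × Y.carrier × Y.carrier => (p.1, p.2.2.1))
        (y := fun p => (p.2.1, p.2.2.1)) ?_
        (Y.ent_symm (Ent.refl _).fst.snd))
      simpa using (Ent.refl _).snd.fst
    simpa [Ent, Holds, diag] using h
  single := by
    have h : Ent A' (fun p : K × Y.carrier × Y.carrier =>
        conj (conj (ε p.1) (Y.eq (f p.1) p.2.1)) (conj (ε p.1) (Y.eq (f p.1) p.2.2)))
        fun p => Y.eq p.2.1 p.2.2 :=
      Y.ent_trans (Y.ent_symm (Ent.refl _).fst.snd) (Ent.refl _).snd.snd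
    simpa [Ent, Holds, diag] using h
  total := by
    have h : Ent A' ε fun i => ⋃ y, conj (ε i) (Y.eq (f i) y) :=
      Ent.exI f ((Ent.refl _).pair hf)
    simpa [Ent, Holds, diag] using h

/-- The morphism given by a map out of an object with diagonal equality. -/
def diagHom (ε : K → Set A) (f : K → Y.carrier) (hf : Ent A' ε fun i => Y.eq (f i) (f i)) :
    diag A' ε ⟶ Y :=
  Quotient.mk (relSetoid _ _) (diagRel ε f hf)

theorem ent_diag_eq (ε : K → Set A) : Ent A' (fun i => (diag A' ε).eq i i) ε := by
  simpa [diag] using Ent.refl ε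

theorem ent_eq_diag (ε : K → Set A) : Ent A' ε (fun i => (diag A' ε).eq i i) := by
  simpa [diag] using Ent.refl ε

/-- The predicate given by a map on an object with diagonal equality. -/
def diagChi (ε φ : K → Set A) : diag A' ε ⟶ Omega A' := chi (diag A' ε) φ (extensional_diag ε φ)

theorem diagHom_comp_chi (ε : K → Set A) (f : K → Y.carrier)
    (hf : Ent A' ε fun i => Y.eq (f i) (f i)) {φ : Y.carrier → Set A} (hφ : Extensional Y φ) :
    diagHom ε f hf ≫ chi Y φ hφ = diagChi ε fun i => φ (f i) := by
  refine (mk_comp_chi (diagRel ε f hf) hφ).trans (chi_eq_iff.2 ?_)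
  refine (ent_diag_eq ε).trans (Ent.pair (Ent.intro ?_) (Ent.intro ?_))
  · exact Ent.exE (Ent.refl _).snd (hφ.ent (Ent.refl _).snd.snd
      (Y.ent_symm (Ent.refl _).snd.fst.snd))
  · exact Ent.exI f (((Ent.refl _).fst.pair ((Ent.refl _).fst.trans hf)).pair (Ent.refl _).snd)

theorem forces_diagChi_iff {ε φ : K → Set A} :
    Forces (diagChi (A' := A') ε φ) ↔ Ent A' ε φ :=
  forces_chi_iff.trans ⟨fun h => (ent_eq_diag ε).trans h, fun h => (ent_diag_eq ε).trans h⟩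

theorem diagChi_comp_chi {ε φ : K → Set A} {J : Set A → Set A} (hJ : Extensional (Omega A') J) :
    diagChi ε φ ≫ chi (Omega A') J hJ = diagChi ε fun i => J (φ i) :=
  chi_comp_chi hJ _

theorem predLE_chi_iff {φ ψ : X.carrier → Set A} {hφ : Extensional X φ} {hψ : Extensional X ψ} :
    PredLE (chi X φ hφ) (chi X ψ hψ) ↔ Ent A' (fun x => conj (X.eq x x) (φ x)) ψ := by
  constructor
  -- The generic stage consists of the elements of `X` at which `φ` is realized; it forces `φ` by
  -- construction.
  · intro h
    have := h (diagHom (fun x => conj (X.eq x x) (φ x)) id (Ent.refl _).fst)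
    rw [diagHom_comp_chi, diagHom_comp_chi, forces_diagChi_iff, forces_diagChi_iff] at this
    exact this (Ent.refl _).snd
  · rintro h Y ⟨F⟩ hF
    have e1 := mk_comp_chi F hφ
    have e2 := mk_comp_chi F hψ
    replace hF := (forces_chi_iff.1 (e1.symm.trans hF))
    refine e2.trans (forces_chi_iff.2 (Ent.exE hF (Ent.exI Prod.snd ?_)))
    exact (Ent.refl _).snd.fst.pair (((F.ent_cod (Ent.refl _).snd.fst).pair (Ent.refl _).snd.snd).trans
      (h.comap Prod.snd))

theorem predLE_diagChi_iff {ε φ ψ : K → Set A} :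
    PredLE (diagChi (A' := A') ε φ) (diagChi ε ψ) ↔ Ent A' (fun i => conj (ε i) (φ i)) ψ :=
  predLE_chi_iff.trans
    ⟨fun h => (((Ent.refl _).fst.trans (ent_eq_diag ε)).pair (Ent.refl _).snd).trans h,
      fun h => (((Ent.refl _).fst.trans (ent_diag_eq ε)).pair (Ent.refl _).snd).trans h⟩

end Discrete

end RT

/-! ### The least solution as a topology and as the oracle modality -/

namespace PartitionedAssembly

open Rz RT

section Modalities

variable {A : Type u} [PCA A] {A' : ElementarySubPCA A} {I : Type*} {Γ : I → Set A}
  (X : PartitionedAssembly A) (P : X.carrier → Set A)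

theorem ent_oracleAsm_rec {S R : I → Set A} (h : Ent A' Γ fun i => imp (S i) (R i))
    (h' : Ent A' (fun p : I × X.carrier =>
      conj (Γ p.1) (conj {X.rho p.2} (imp (P p.2) (R p.1)))) fun p => R p.1)
    (h'' : Ent A' Γ fun i => oracleAsm X P (S i)) : Ent A' Γ R :=
  ((h.pair (Ent.allI h')).pair h'').trans (ent_oracleAsm_elim X P S R)

/-- Grafting dialogue trees onto leaves. Monotonicity, idempotence and extensionality all reduce to
this. -/
theorem ent_oracleAsm_bind {S R : I → Set A}
    (h : Ent A' Γ fun i => imp (S i) (oracleAsm X P (R i)))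
    (h' : Ent A' Γ fun i => oracleAsm X P (S i)) : Ent A' Γ fun i => oracleAsm X P (R i) :=
  ent_oracleAsm_rec X P h ((Ent.refl _).snd.trans
    (ent_oracleAsm_ask X P (fun p : I × X.carrier => R p.1) Prod.snd)) h'

theorem extensional_oracleAsm : Extensional (Omega A') (oracleAsm X P) :=
  extensional_of_ent (ent_oracleAsm_bind X P
    (Ent.intro (((Ent.refl _).fst.snd.fst.mp (Ent.refl _).snd).trans (ent_oracleAsm_unit X P _)))
    (Ent.refl _).fst)

/-- The least solution represents a Lawvere–Tierney topology. -/
theorem isLawvereTierney_of_represents {j : Omega A' ⟶ Omega A'}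
    (h : Represents (oracleAsm X P) j) : IsLawvereTierney j := by
  obtain ⟨hJ, rfl⟩ := h
  refine ⟨fun Y p q hpq => ?_, fun Y p => ?_, fun Y p => ?_⟩ <;>
    obtain ⟨φ, hφ, rfl⟩ := exists_eq_chi p
  · obtain ⟨ψ, hψ, rfl⟩ := exists_eq_chi q
    rw [predLE_chi_iff] at hpq
    rw [chi_comp_chi, chi_comp_chi, predLE_chi_iff]
    exact ent_oracleAsm_bind X P (Ent.intro ((((Ent.refl _).fst.fst.pair (Ent.refl _).snd).trans
      hpq).trans (ent_oracleAsm_unit X P _))) (Ent.refl _).snd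
  · rw [chi_comp_chi, predLE_chi_iff]
    exact (Ent.refl _).snd.trans (ent_oracleAsm_unit X P _)
  · rw [chi_comp_chi, chi_comp_chi, predLE_chi_iff]
    exact ent_oracleAsm_bind X P (Ent.intro (Ent.refl _).snd) (Ent.refl _).snd

theorem ent_eq_self_of_rho {x : I → X.carrier} (h : Ent A' Γ fun i => {X.rho (x i)}) :
    Ent A' Γ fun i => (X.toRT A').eq (x i) (x i) := by
  simpa [toRT] using h

theorem ent_rho_of_eq_self {x : I → X.carrier}
    (h : Ent A' Γ fun i => (X.toRT A').eq (x i) (x i)) : Ent A' Γ fun i => {X.rho (x i)} := by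
  simpa [toRT] using h

/-- A morphism represented by the least solution is the oracle modality. -/
theorem isOracleModality_of_represents {j : Omega A' ⟶ Omega A'}
    (h : Represents (oracleAsm X P) j) : IsOracleModality (X.predicate A' P) j := by
  have hLT := X.isLawvereTierney_of_represents P h
  obtain ⟨hJ, rfl⟩ := h
  refine ⟨hLT.inflationary, ?_, ?_⟩
  · rintro Y s ⟨G⟩ h
    obtain ⟨σ, hσ, rfl⟩ := exists_eq_chi s
    have e := mk_comp_chi G (X.extensional A' P)
    rw [chi_comp_chi] at h ⊢
    replace h : PredLE (chi Y _ (extensional_pullback G)) _ := e ▸ h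
    rw [predLE_chi_iff] at h
    rw [forces_chi_iff]
    -- The generalized element `a` is only a functional relation `G`; totality supplies a point `x`
    -- related to `y`, and the question asked is that `x`.
    refine Ent.exE (G.ent_total (Ent.refl _)) (Ent.trans ?_
      (ent_oracleAsm_ask X P (fun p : Y.carrier × X.carrier => σ p.1) Prod.snd))
    refine Ent.pair (ent_rho_of_eq_self X (G.ent_cod (Ent.refl _).snd)) (Ent.intro ?_)
    have h' : Ent A' (fun p : Y.carrier × X.carrier =>
        conj (Y.eq p.1 p.1) (⋃ x, conj (G.rel p.1 x) (P x)))
        fun p => oracleAsm X P (σ p.1) := h.comap Prod.fst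
    refine Ent.trans (Ent.pair (Ent.refl _).fst.fst ?_) h'
    exact Ent.exI Prod.snd ((Ent.refl _).fst.snd.pair (Ent.refl _).snd)
  · intro Y s r hsr hask
    obtain ⟨σ, hσ, rfl⟩ := exists_eq_chi s
    obtain ⟨τ, hτ, rfl⟩ := exists_eq_chi r
    rw [predLE_chi_iff] at hsr
    rw [chi_comp_chi, predLE_chi_iff]
    refine ent_oracleAsm_rec X P (Ent.intro (((Ent.refl _).fst.fst.pair (Ent.refl _).snd).trans
      hsr)) ?_ (Ent.refl _).snd
    -- The generic stage for the closure hypothesis: a point of `Y`, a question `x`, and a realizer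
    -- of `P x ⇒ r`. The two projections are the maps to `Y` and `X` at which the hypothesis is
    -- instantiated.
    let ε : Y.carrier × X.carrier → Set A := fun p =>
      conj (Y.eq p.1 p.1) (conj {X.rho p.2} (imp (P p.2) (τ p.1)))
    have h := hask _ (diagHom ε Prod.fst (Ent.refl _).fst)
      (diagHom ε Prod.snd (ent_eq_self_of_rho X (Ent.refl _).snd.fst))
    have hP : diagHom ε Prod.snd (ent_eq_self_of_rho X (Ent.refl _).snd.fst) ≫ X.predicate A' P =
        diagChi ε fun p => P p.2 := diagHom_comp_chi ε _ _ _
    rw [hP, diagHom_comp_chi, predLE_diagChi_iff, forces_diagChi_iff] at h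
    exact ((Ent.refl _).fst.fst.pair (Ent.refl _).snd).trans
      (h ((Ent.refl _).fst.snd.snd.mp (Ent.refl _).snd))

end Modalities

/-! ### Every topology is an oracle modality -/

section Representation

variable {A : Type u} [PCA A] {A' : ElementarySubPCA A}

/-- The pairs of a truth value `S` and a realizer of `J S`. -/
def ofMap (J : Set A → Set A) : PartitionedAssembly A where
  carrier := {p : A × Set A // p.1 ∈ J p.2}
  rho p := p.1.1

/-- Every realizer of every `J S` is a question whose answers are the realizers of `S`. Thus `J S`
entails the least solution by asking one question, and the topology axioms collapse any dialogue
back into `J S`. -/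
theorem represents_of_isLawvereTierney {J : Set A → Set A} {hJ : Extensional (Omega A') J}
    (h : IsLawvereTierney (chi (Omega A') J hJ)) :
    Represents (oracleAsm (ofMap J) fun p => p.1.2) (chi (Omega A') J hJ) := by
  have mono : Ent A' (fun p : Set A × Set A => conj (imp p.1 p.2) (J p.1)) fun p => J p.2 := by
    -- Instantiating at the generic implication between two truth values makes the realizer uniform.
    -- The next two facts use the generic realized `S` and the generic `S` with `J (J S)` realized.
    have := h.monotone _ (diagChi (fun p : Set A × Set A => imp p.1 p.2) Prod.fst)
      (diagChi _ Prod.snd)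
    rw [diagChi_comp_chi, diagChi_comp_chi, predLE_diagChi_iff, predLE_diagChi_iff] at this
    exact this ((Ent.refl _).fst.mp (Ent.refl _).snd)
  have unit : Ent A' (fun S : Set A => S) J := by
    have := h.inflationary _ (diagChi (fun S : Set A => S) fun S => S)
    rw [diagChi_comp_chi, predLE_diagChi_iff] at this
    exact ((Ent.refl _).pair (Ent.refl _)).trans this
  have idem : Ent A' (fun S => J (J S)) J := by
    have := h.idempotent _ (diagChi (fun S : Set A => J (J S)) fun S => S)
    rw [diagChi_comp_chi, diagChi_comp_chi, predLE_diagChi_iff] at this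
    exact ((Ent.refl _).pair (Ent.refl _)).trans this
  let P : (ofMap J).carrier → Set A := fun p => p.1.2
  have ask : Ent A' J (oracleAsm (ofMap J) P) := by
    have : Ent A' (fun x : (ofMap J).carrier => {(ofMap J).rho x})
        fun x => oracleAsm (ofMap J) P (P x) :=
      ((Ent.refl _).pair (Ent.intro ((Ent.refl _).snd.trans (ent_oracleAsm_unit _ _ _)))).trans
        (ent_oracleAsm_ask (ofMap J) P P fun x => x)
    obtain ⟨e, he, h⟩ := ent_iff.1 this
    -- Since `a` is the realizer of the point `(a, S)`, a program uniform in the points is a program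
    -- uniform in `S` and `a ∈ J S`.
    exact ent_iff.2 ⟨e, he, fun S a ha => h ⟨(a, S), ha⟩ a rfl⟩
  have elim : Ent A' (oracleAsm (ofMap J) P) J := by
    have hρ : Ent A' (fun x : (ofMap J).carrier => {(ofMap J).rho x}) fun x => J (P x) := by
      refine ent_iff.2 ⟨PCA.iE, iE_mem, ?_⟩
      rintro x _ rfl
      exact ⟨(ofMap J).rho x, by simp, x.2⟩
    refine ent_oracleAsm_rec (ofMap J) P (S := fun S => S) (Ent.intro ((Ent.refl _).snd.trans unit))
      ?_ (Ent.refl _)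
    have hρ' : Ent A' (fun p : Set A × (ofMap J).carrier => {(ofMap J).rho p.2})
        fun p => J (P p.2) := hρ.comap Prod.snd
    have mono' : Ent A' (fun p : Set A × (ofMap J).carrier =>
        conj (imp (P p.2) (J p.1)) (J (P p.2))) fun p => J (J p.1) :=
      mono.comap fun p : Set A × (ofMap J).carrier => (P p.2, J p.1)
    have idem' : Ent A' (fun p : Set A × (ofMap J).carrier => J (J p.1)) fun p => J p.1 :=
      idem.comap Prod.fst
    -- At a node, the subtrees realize `P x ⇒ J S` and the question realizes `J (P x)`; monotonicity
    -- gives `J (J S)` and idempotence gives `J S`.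
    exact (((Ent.refl _).snd.snd.pair ((Ent.refl _).snd.fst.trans hρ')).trans mono').trans idem'
  exact ⟨extensional_oracleAsm _ _, chi_eq_iff.2
    (Ent.pair (Ent.intro ((Ent.refl _).snd.trans ask)) (Ent.intro ((Ent.refl _).snd.trans elim)))⟩

/-- A point enters the formula only through `ρ x` and `P x`, so points may be grouped by realizer
without changing the operator. -/
theorem oracleAsm_eq_oracleWeihrauch (X : PartitionedAssembly A) (P : X.carrier → Set A) :
    oracleAsm X P = oracleWeihrauch fun b => {θ | ∃ x, X.rho x = b ∧ P x = θ} := by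
  funext S
  unfold oracleAsm oracleWeihrauch
  congr 2
  funext T
  congr 1
  ext e
  simp only [Set.mem_iUnion, Set.mem_ofPred_eq]
  constructor
  · rintro ⟨x, c, hc, rfl⟩
    exact ⟨_, _, ⟨x, rfl, rfl⟩, c, hc, rfl⟩
  · rintro ⟨_, _, ⟨x, rfl, rfl⟩, c, hc, rfl⟩
    exact ⟨x, c, hc, rfl⟩

/-- The points are the instances `(b, θ)` of `f`; regrouping them by `b` recovers `f` exactly. -/
theorem oracleWeihrauch_eq_oracleAsm (f : A → Set (Set A)) :
    oracleWeihrauch f = oracleAsm ⟨{p : A × Set A // p.2 ∈ f p.1}, fun p => p.1.1⟩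
      fun p => p.1.2 := by
  rw [oracleAsm_eq_oracleWeihrauch]
  congr 1
  funext b
  ext θ
  simp

end Representation

end PartitionedAssembly

theorem mainTheorem11 {A : Type u} [PCA A] (A' : ElementarySubPCA A)
    (j : RT.Omega A' ⟶ RT.Omega A') :
    (RT.IsLawvereTierney j ↔
      ∃ (X : PartitionedAssembly A) (P : X.carrier → Set A),
        RT.IsOracleModality (X.predicate A' P) j ∧ RT.Represents (oracleAsm X P) j) ∧
    (RT.IsLawvereTierney j ↔
      ∃ f : A → Set (Set A), RT.Represents (oracleWeihrauch f) j) := by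
  have key (h : RT.IsLawvereTierney j) : ∃ (X : PartitionedAssembly A) (P : X.carrier → Set A),
      RT.Represents (oracleAsm X P) j := by
    obtain ⟨J, hJ, rfl⟩ := RT.exists_eq_chi j
    exact ⟨_, _, PartitionedAssembly.represents_of_isLawvereTierney h⟩
  refine ⟨⟨fun h => ?_, fun ⟨X, P, _, h⟩ => X.isLawvereTierney_of_represents P h⟩,
    ⟨fun h => ?_, fun ⟨f, h⟩ => ?_⟩⟩
  · obtain ⟨X, P, hXP⟩ := key h
    exact ⟨X, P, X.isOracleModality_of_represents P hXP, hXP⟩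
  · obtain ⟨X, P, hXP⟩ := key h
    exact ⟨_, X.oracleAsm_eq_oracleWeihrauch P ▸ hXP⟩
  · rw [PartitionedAssembly.oracleWeihrauch_eq_oracleAsm] at h
    exact PartitionedAssembly.isLawvereTierney_of_represents _ _ h
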